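/- **Setting.** Let $X$ and $Z\subset X$ be complex Hilbert spaces, $\mathfrak A_0\in\mathcal L(Z,X)$, $\mathfrak B,\mathfrak C\in\mathcal L(Z,\mathbb C^p)$, $\mathfrak B_d\in\mathcal L(Z,\mathbb C^{n_3})$, $B_d\in\mathcal L(\mathbb C^{n_1},X)$, and consider the boundary control system $$\dot x=\mathfrak A_0x+B_dw_1,\qquad \mathfrak Bx=u+w_2,\qquad \mathfrak B_dx=w_3,\qquad y=\mathfrak Cx .$$ We call it *admissible* if (i) $A=\mathfrak A_0|_{\ker\mathfrak B\cap\ker\mathfrak B_d}$ generates a contraction semigroup on $X$; (ii) $\begin{bmatrix}\mathfrak B\\ \mathfrak B_d\end{bmatrix}:Z\to\mathbb C^{p+n_3}$ is surjective; (iii) $\operatorname{Re}\langle\mathfrak A_0x,x\rangle\le\operatorname{Re}\langle\mathfrak Bx,\mathfrak Cx\rangle$ for all $x\in\ker\mathfrak B_d$. No well-posedness is assumed. The system is coupled with the controller on $X_c=\mathbb C^{n_c}$ $$\dot x_c=J_cx_c+\delta_cB_c(y_{\rm ref}-y),\qquad u=\delta_cB_c^*x_c+D_c(y_{\rm ref}-y).$$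 For $D_c=0$ put $$\mathfrak A_e=\begin{pmatrix}\mathfrak A_0&0\\-\delta_cB_c\mathfrak C&J_c\end{pmatrix},\qquad \mathfrak B_e=\begin{pmatrix}\mathfrak B&-\delta_cB_c^*\\ \mathfrak B_d&0\end{pmatrix},\qquad A_e=\mathfrak A_e|_{\ker\mathfrak B_e}\ \text{ on } X\times X_c .$$ Let $0=\omega_0<\omega_1<\dots<\omega_q$. A signal is *of the form (S)* if it equals $a_0+\sum_{k=1}^q\big(a_k^1\cos(\omega_kt)+a_k^2\sin(\omega_kt)\big)$ with constant complex vectors $a_0,a_k^1,a_k^2$. A *closed-loop state* for $y_{\rm ref},w_1,w_2,w_3$ is a pair $x\in C([0,\infty);Z)\cap C^1([0,\infty);X)$, $x_c\in C^1([0,\infty);X_c)$ that satisfies all the above equations for every $t\ge0$. The controller *solves the robust output regulation problem* if (a) $A_e$ generates an exponentially stable semigroup; (b) there is $\alpha>0$ such that for all $y_{\rm ref},w_1,w_2,w_3$ of the form (S) and all $x(0)\in Z$, $x_c(0)\in X_c$ satisfying the boundary conditions at $t=0$, the closed-loop state exists and $e^{\alpha t}\|y(t)-y_{\rm ref}(t)\|\to0$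 as $t\to\infty$; (c) whenever the plant $(\mathfrak A_0,\mathfrak B,\mathfrak B_d,B_d,\mathfrak C)$ is replaced by any admissible plant on the same spaces for which the closed-loop operator generates an exponentially stable semigroup, (b) continues to hold for the new plant, with some $\tilde\alpha>0$. **Theorem.** Let the plant be admissible and let the controller satisfy $J_c^*=-J_c$, $D_c=0$ and $\delta_c>0$. If $A_e$ generates an exponentially stable semigroup and $$\operatorname{ran}(\pm i\omega_k-J_c)\cap\operatorname{ran}(B_c)=\{0\}\quad(k=0,\dots,q),\qquad \ker(B_c)=\{0\},$$ then the controller solves the robust output regulation problem. In particular, there is $\alpha>0$ such that for all $y_{\rm ref},w_1,w_2,w_3$ of the form (S) and all $x(0)\in Z$, $x_c(0)\in X_c$ with $\mathfrak Bx(0)=\delta_cB_c^*x_c(0)+w_2(0)$ and $\mathfrak B_dx(0)=w_3(0)$, the closed-loop state exists and $e^{\alpha t}\|y(t)-y_{\rm ref}(t)\|\to0$ as $t\to\infty$. -/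

import Mathlib

open Filter Topology Set

/-- Euclidean space `ℂⁿ`. -/
abbrev CVec (n : ℕ) : Type := EuclideanSpace ℂ (Fin n)

/-! ### Strongly continuous semigroups -/

section Semigroup

variable {Y : Type*} [NormedAddCommGroup Y] [NormedSpace ℂ Y]

/-- `T` (restricted to `[0, ∞)`) is a strongly continuous semigroup of bounded operators. -/
structure IsC0Semigroup (T : ℝ → Y →L[ℂ] Y) : Prop where
  zero : T 0 = ContinuousLinearMap.id ℂ Y
  add : ∀ s t : ℝ, 0 ≤ s → 0 ≤ t → T (s + t) = (T s).comp (T t)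
  strongCont : ∀ y : Y, Tendsto (fun t : ℝ => T t y) (𝓝[≥] 0) (𝓝 y)

/-- The operator with graph `G` is the infinitesimal generator of `T`: `(x, y)` lies in the graph
iff `(T h x - x) / h → y` as `h → 0+`. -/
def IsGeneratorGraph (T : ℝ → Y →L[ℂ] Y) (G : Submodule ℂ (Y × Y)) : Prop :=
  ∀ x y : Y, (x, y) ∈ G ↔
    Tendsto (fun h : ℝ => ((h⁻¹ : ℝ) : ℂ) • (T h x - x)) (𝓝[>] 0) (𝓝 y)

/-- The operator with graph `G` generates a contraction semigroup. -/
def GeneratesContractionSemigroup (G : Submodule ℂ (Y × Y)) : Prop :=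
  ∃ T : ℝ → Y →L[ℂ] Y, IsC0Semigroup T ∧ IsGeneratorGraph T G ∧ ∀ t : ℝ, 0 ≤ t → ‖T t‖ ≤ 1

/-- The operator with graph `G` generates an exponentially stable semigroup. -/
def GeneratesExpStableSemigroup (G : Submodule ℂ (Y × Y)) : Prop :=
  ∃ T : ℝ → Y →L[ℂ] Y, IsC0Semigroup T ∧ IsGeneratorGraph T G ∧
    ∃ M > (0 : ℝ), ∃ a > (0 : ℝ), ∀ t : ℝ, 0 ≤ t → ‖T t‖ ≤ M * Real.exp (-a * t)

end Semigroup

/-! ### The plant -/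

/-- The data of a boundary control and observation system
`x' = 𝔄₀ x + E w₁`, `𝔅 x = u + w₂`, `𝔅_d x = w₃`, `y = ℭ x`.
The inclusion `Z ⊆ X` of Hilbert spaces is the injective linear map `ι`; its continuity is not
needed and not required. `E` is the distributed disturbance input operator `B_d`, and `Bd` is the
boundary disturbance operator `𝔅_d`. -/
structure BoundarySystem (X Z : Type*) [NormedAddCommGroup X] [InnerProductSpace ℂ X]
    [NormedAddCommGroup Z] [InnerProductSpace ℂ Z] (p n₁ n₃ : ℕ) where
  ι : Z →ₗ[ℂ] X
  ι_injective : Function.Injective ι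
  A₀ : Z →L[ℂ] X
  B : Z →L[ℂ] CVec p
  Bd : Z →L[ℂ] CVec n₃
  E : CVec n₁ →L[ℂ] X
  C : Z →L[ℂ] CVec p

namespace BoundarySystem

variable {X Z : Type*} [NormedAddCommGroup X] [InnerProductSpace ℂ X]
  [NormedAddCommGroup Z] [InnerProductSpace ℂ Z] {p n₁ n₃ : ℕ}

/-- The graph in `X × X` of `A = 𝔄₀` restricted to `Dom A = ker 𝔅 ∩ ker 𝔅_d`. -/
def graphA (S : BoundarySystem X Z p n₁ n₃) : Submodule ℂ (X × X) :=
  (LinearMap.ker (S.B : Z →ₗ[ℂ] CVec p) ⊓ LinearMap.ker (S.Bd : Z →ₗ[ℂ] CVec n₃)).map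
    (S.ι.prod (S.A₀ : Z →ₗ[ℂ] X))

/-- The standing assumptions on the plant. -/
structure Admissible (S : BoundarySystem X Z p n₁ n₃) : Prop where
  generates : GeneratesContractionSemigroup S.graphA
  surjective : Function.Surjective (fun z : Z => (S.B z, S.Bd z))
  /-- Impedance passivity: `Re ⟨𝔄x, x⟩ ≤ Re ⟨𝔅x, ℭx⟩` on `Dom 𝔄 = ker 𝔅_d`. -/
  passive : ∀ z : Z, S.Bd z = 0 →
    (inner ℂ (S.A₀ z) (S.ι z)).re ≤ (inner ℂ (S.B z) (S.C z)).re

end BoundarySystem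

/-! ### The controller and the closed-loop system -/

/-- The data of an error feedback controller on `X_c = ℂ^{n_c}`:
`x_c' = J x_c + δ B (y_ref - y)`, `u = δ B* x_c + D (y_ref - y)`. -/
structure ErrorController (p nc : ℕ) where
  J : CVec nc →L[ℂ] CVec nc
  B : CVec p →L[ℂ] CVec nc
  D : CVec p →L[ℂ] CVec p
  δ : ℝ

/-- Signals of the form `a₀ + ∑_{k=1}^q (a_k¹ cos (ω_k t) + a_k² sin (ω_k t))`. -/
def IsTrigSignal {q n : ℕ} (ω : Fin (q + 1) → ℝ) (f : ℝ → CVec n) : Prop :=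
  ∃ (a₀ : CVec n) (a₁ a₂ : Fin q → CVec n), ∀ t : ℝ,
    f t = a₀ + ∑ k : Fin q, (((Real.cos (ω k.succ * t) : ℝ) : ℂ) • a₁ k +
      ((Real.sin (ω k.succ * t) : ℝ) : ℂ) • a₂ k)

namespace ErrorController

variable {X Z : Type*} [NormedAddCommGroup X] [InnerProductSpace ℂ X]
  [NormedAddCommGroup Z] [InnerProductSpace ℂ Z] {p n₁ n₃ nc : ℕ}

/-- The control `u = δ B* x_c + D (r - y)` for controller state `xc`, output `y`, reference `r`. -/
noncomputable def control (K : ErrorController p nc) (xc : CVec nc) (y r : CVec p) : CVec p :=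
  (K.δ : ℂ) • ContinuousLinearMap.adjoint K.B xc + K.D (r - y)

/-- `𝔄_e = [𝔄₀, 0; -δ B ℭ, J]` on `Z × X_c`. -/
noncomputable def opAe (K : ErrorController p nc) (S : BoundarySystem X Z p n₁ n₃) :
    Z × CVec nc →ₗ[ℂ] X × CVec nc where
  toFun v := (S.A₀ v.1, -((K.δ : ℂ) • K.B (S.C v.1)) + K.J v.2)
  map_add' v w := by
    ext1
    · simp
    · simp only [Prod.fst_add, Prod.snd_add, map_add, smul_add]; abel
  map_smul' c v := by
    ext1
    · simp
    · simp only [Prod.smul_fst, Prod.smul_snd, map_smul, RingHom.id_apply, smul_add, smul_neg,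
        smul_comm c (K.δ : ℂ)]

/-- `𝔅_e = [𝔅 + D ℭ, -δ B*; 𝔅_d, 0]` on `Z × X_c` (for `D = 0` this is `[𝔅, -δ B*; 𝔅_d, 0]`). -/
noncomputable def opBe (K : ErrorController p nc) (S : BoundarySystem X Z p n₁ n₃) :
    Z × CVec nc →ₗ[ℂ] CVec p × CVec n₃ where
  toFun v :=
    (S.B v.1 + K.D (S.C v.1) - (K.δ : ℂ) • ContinuousLinearMap.adjoint K.B v.2, S.Bd v.1)
  map_add' v w := by
    ext1
    · simp only [Prod.fst_add, Prod.snd_add, map_add, smul_add]; abel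
    · simp
  map_smul' c v := by
    ext1
    · simp only [Prod.smul_fst, Prod.smul_snd, map_smul, RingHom.id_apply, smul_add, smul_sub,
        smul_comm c (K.δ : ℂ)]
    · simp

/-- The graph of the closed-loop operator `A_e = 𝔄_e` restricted to `ker 𝔅_e`, in `X_e × X_e` with
`X_e = X × X_c`. The product carries the maximum norm, which is equivalent to the Hilbert norm;
generation and exponential stability of a semigroup depend only on the norm up to equivalence. -/
noncomputable def graphAe (K : ErrorController p nc) (S : BoundarySystem X Z p n₁ n₃) :
    Submodule ℂ ((X × CVec nc) × (X × CVec nc)) :=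
  (LinearMap.ker (K.opBe S)).map ((S.ι.prodMap LinearMap.id).prod (K.opAe S))

/-- `(x, xc)` is a closed-loop state on `[0, ∞)`, i.e. a classical solution
`x ∈ C([0,∞); Z) ∩ C¹([0,∞); X)`, `xc ∈ C¹([0,∞); X_c)` of the plant connected to the controller,
for the reference `r` and the disturbances `w₁, w₂, w₃`. (Continuity of the derivatives follows
from the equations when the signals are continuous.) -/
structure IsClosedLoopState (K : ErrorController p nc) (S : BoundarySystem X Z p n₁ n₃)
    (r : ℝ → CVec p) (w₁ : ℝ → CVec n₁) (w₂ : ℝ → CVec p) (w₃ : ℝ → CVec n₃)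
    (x : ℝ → Z) (xc : ℝ → CVec nc) : Prop where
  continuousOn : ContinuousOn x (Ici 0)
  plant : ∀ t : ℝ, 0 ≤ t →
    HasDerivWithinAt (fun s => S.ι (x s)) (S.A₀ (x t) + S.E (w₁ t)) (Ici 0) t
  boundary : ∀ t : ℝ, 0 ≤ t → S.B (x t) = K.control (xc t) (S.C (x t)) (r t) + w₂ t
  boundary_dist : ∀ t : ℝ, 0 ≤ t → S.Bd (x t) = w₃ t
  controller : ∀ t : ℝ, 0 ≤ t →
    HasDerivWithinAt xc (K.J (xc t) + (K.δ : ℂ) • K.B (r t - S.C (x t))) (Ici 0) t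

/-- The regulation error decays at the exponential rate `α` for the given signals and the given
initial state: the closed-loop state exists, and along every such state
`e^{αt} ‖y(t) - y_ref(t)‖ → 0`. -/
def ErrorDecaysFrom (K : ErrorController p nc) (S : BoundarySystem X Z p n₁ n₃) (α : ℝ)
    (r : ℝ → CVec p) (w₁ : ℝ → CVec n₁) (w₂ : ℝ → CVec p) (w₃ : ℝ → CVec n₃)
    (x₀ : Z) (xc₀ : CVec nc) : Prop :=
  (∃ (x : ℝ → Z) (xc : ℝ → CVec nc),
      K.IsClosedLoopState S r w₁ w₂ w₃ x xc ∧ x 0 = x₀ ∧ xc 0 = xc₀) ∧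
    ∀ (x : ℝ → Z) (xc : ℝ → CVec nc),
      K.IsClosedLoopState S r w₁ w₂ w₃ x xc → x 0 = x₀ → xc 0 = xc₀ →
        Tendsto (fun t : ℝ => Real.exp (α * t) * ‖S.C (x t) - r t‖) atTop (𝓝 0)

/-- Output tracking and disturbance rejection with a common exponential rate, for all signals with
frequencies `ω` and all initial states compatible with the boundary conditions. -/
def Regulates (K : ErrorController p nc) (S : BoundarySystem X Z p n₁ n₃)
    {q : ℕ} (ω : Fin (q + 1) → ℝ) : Prop :=
  ∃ α > (0 : ℝ), ∀ (r : ℝ → CVec p) (w₁ : ℝ → CVec n₁) (w₂ : ℝ → CVec p) (w₃ : ℝ → CVec n₃),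
    IsTrigSignal ω r → IsTrigSignal ω w₁ → IsTrigSignal ω w₂ → IsTrigSignal ω w₃ →
    ∀ (x₀ : Z) (xc₀ : CVec nc),
      S.B x₀ = K.control xc₀ (S.C x₀) (r 0) + w₂ 0 → S.Bd x₀ = w₃ 0 →
        K.ErrorDecaysFrom S α r w₁ w₂ w₃ x₀ xc₀

/-- The robust output regulation problem. The perturbed plants `S'` are all plants on the same
spaces that satisfy the standing assumptions (no smallness is required). -/
structure SolvesRobustOutputRegulation (K : ErrorController p nc)
    (S : BoundarySystem X Z p n₁ n₃) {q : ℕ} (ω : Fin (q + 1) → ℝ) : Prop where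
  stable : GeneratesExpStableSemigroup (K.graphAe S)
  regulates : K.Regulates S ω
  robust : ∀ S' : BoundarySystem X Z p n₁ n₃, S'.Admissible →
    GeneratesExpStableSemigroup (K.graphAe S') → K.Regulates S' ω

end ErrorController

/-! ### Exponentially stable semigroups -/

section ExpStable

variable {Y : Type*} [NormedAddCommGroup Y] [NormedSpace ℂ Y]
  {T : ℝ → Y →L[ℂ] Y} {G : Submodule ℂ (Y × Y)} {M a : ℝ}

theorem IsC0Semigroup.add_apply (hT : IsC0Semigroup T) {s t : ℝ} (hs : 0 ≤ s) (ht : 0 ≤ t)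
    (y : Y) : T (s + t) y = T s (T t y) := by
  rw [hT.add s t hs ht]; rfl

theorem norm_le_of_exp_bound (hM : 0 < M) (ha : 0 < a)
    (hb : ∀ t : ℝ, 0 ≤ t → ‖T t‖ ≤ M * Real.exp (-a * t)) {t : ℝ} (ht : 0 ≤ t) : ‖T t‖ ≤ M := by
  refine (hb t ht).trans (mul_le_of_le_one_right hM.le (Real.exp_le_one_iff.2 ?_))
  nlinarith

theorem IsC0Semigroup.continuousOn_orbit (hT : IsC0Semigroup T)
    (hb : ∀ t : ℝ, 0 ≤ t → ‖T t‖ ≤ M) (y : Y) : ContinuousOn (fun t => T t y) (Ici 0) := by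
  intro t₀ ht₀
  have h0 : Tendsto (fun s : ℝ => |s - t₀|) (𝓝[Ici 0] t₀) (𝓝[≥] 0) := by
    refine tendsto_nhdsWithin_iff.2 ⟨?_, Eventually.of_forall fun s => mem_Ici.2 (abs_nonneg _)⟩
    have : Continuous fun s : ℝ => |s - t₀| := by fun_prop
    simpa using (this.tendsto t₀).mono_left nhdsWithin_le_nhds
  have h1 : Tendsto (fun s : ℝ => M * ‖T |s - t₀| y - y‖) (𝓝[Ici 0] t₀) (𝓝 0) := by
    have := ((((hT.strongCont y).comp h0).sub_const y).norm).const_mul M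
    simpa using this
  refine tendsto_iff_norm_sub_tendsto_zero.2 (squeeze_zero' (Eventually.of_forall fun _ =>
    norm_nonneg _) ?_ h1)
  have key : ∀ s t : ℝ, 0 ≤ s → s ≤ t → ‖T t y - T s y‖ ≤ M * ‖T |t - s| y - y‖ := by
    intro s t hs hst
    have : T t y - T s y = T s (T |t - s| y - y) := by
      rw [map_sub, ← hT.add_apply hs (abs_nonneg _), abs_of_nonneg (sub_nonneg.2 hst)]
      congr 3; ring
    rw [this]
    exact (T s).le_of_opNorm_le (hb s hs) _
  filter_upwards [self_mem_nhdsWithin] with s hs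
  rcases le_total s t₀ with h | h
  · rw [norm_sub_rev, abs_sub_comm]; exact key s t₀ hs h
  · exact key t₀ s ht₀ h

theorem IsGeneratorGraph.orbit_mem (hT : IsC0Semigroup T) (hG : IsGeneratorGraph T G) {x y : Y}
    (h : (x, y) ∈ G) {t : ℝ} (ht : 0 ≤ t) : (T t x, T t y) ∈ G := by
  rw [hG] at h ⊢
  refine (((T t).continuous.tendsto y).comp h).congr' ?_
  filter_upwards [self_mem_nhdsWithin] with s hs
  have hs' : (0 : ℝ) ≤ s := (mem_Ioi.1 hs).le
  simp only [Function.comp, map_smul, map_sub]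
  rw [← hT.add_apply ht hs', ← hT.add_apply hs' ht, add_comm]

theorem IsGeneratorGraph.hasDerivWithinAt_orbit [CompleteSpace Y] (hT : IsC0Semigroup T)
    (hG : IsGeneratorGraph T G)
    (hb : ∀ t : ℝ, 0 ≤ t → ‖T t‖ ≤ M) {x y : Y} (h : (x, y) ∈ G) {t : ℝ} (ht : 0 ≤ t) :
    HasDerivWithinAt (fun s => T s x) (T t y) (Ici 0) t := by
  have hmax : ∀ z : Y, Continuous fun s : ℝ => T (max s 0) z := fun z =>
    (hT.continuousOn_orbit hb z).comp_continuous (by fun_prop) fun s => mem_Ici.2 (le_max_right _ _)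
  have hr : ∀ s : ℝ, 0 ≤ s → HasDerivWithinAt (fun s => T s x) (T s y) (Ioi s) s := by
    intro s hs
    have hm := (hG _ _).1 (hG.orbit_mem hT h hs)
    rw [hasDerivWithinAt_iff_tendsto_slope' (by simp)]
    have hsub : Tendsto (fun u : ℝ => u - s) (𝓝[>] s) (𝓝[>] 0) := by
      refine tendsto_nhdsWithin_iff.2 ⟨?_, ?_⟩
      · have : Continuous fun u : ℝ => u - s := by fun_prop
        simpa using (this.tendsto s).mono_left nhdsWithin_le_nhds
      · filter_upwards [self_mem_nhdsWithin] with u hu using sub_pos.2 (mem_Ioi.1 hu)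
    refine (hm.comp hsub).congr' ?_
    filter_upwards [self_mem_nhdsWithin] with u hu
    have hu' : 0 ≤ u - s := (sub_pos.2 (mem_Ioi.1 hu)).le
    simp only [Function.comp, slope, vsub_eq_sub]
    rw [← hT.add_apply hu' hs, sub_add_cancel, Complex.coe_smul]
  have hint : ∀ s : ℝ, 0 ≤ s → T s x = x + ∫ u in (0 : ℝ)..s, T (max u 0) y := by
    intro s hs
    have := intervalIntegral.integral_eq_sub_of_hasDeriv_right_of_le (f := fun u => T u x)
      (f' := fun u => T (max u 0) y) hs
      ((hT.continuousOn_orbit hb x).mono Icc_subset_Ici_self)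
      (fun u hu => by
        have := hr u hu.1.le
        simpa [max_eq_left hu.1.le] using this)
      ((hmax y).intervalIntegrable _ _)
    rw [this, hT.zero]; simp
  have hd : HasDerivAt (fun s => x + ∫ u in (0 : ℝ)..s, T (max u 0) y) (T (max t 0) y) t :=
    ((hmax y).integral_hasStrictDerivAt 0 t).hasDerivAt.const_add x
  rw [max_eq_left ht] at hd
  exact hd.hasDerivWithinAt.congr (fun s hs => hint s hs) (hint t ht)

theorem IsGeneratorGraph.eq_orbit [CompleteSpace Y] (hT : IsC0Semigroup T)
    (hG : IsGeneratorGraph T G) (hb : ∀ t : ℝ, 0 ≤ t → ‖T t‖ ≤ M) {v v' : ℝ → Y}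
    (hv : ∀ t, 0 ≤ t → HasDerivWithinAt v (v' t) (Ici 0) t)
    (hmem : ∀ t, 0 ≤ t → (v t, v' t) ∈ G) {t : ℝ} (ht : 0 ≤ t) : v t = T t (v 0) := by
  have hd : ∀ s ∈ Icc 0 t, HasDerivWithinAt (fun u => T (t - u) (v u)) 0 (Icc 0 t) s := by
    intro s hs
    have hmaps : MapsTo (fun u : ℝ => t - u) (Icc 0 t) (Ici 0) := fun u hu => sub_nonneg.2 hu.2
    have hvs := (hv s hs.1).mono (Icc_subset_Ici_self : Icc 0 t ⊆ Ici 0)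
    have h1 : HasDerivWithinAt (fun u => T (t - u) (v u - v s - (u - s) • v' s)) 0 (Icc 0 t) s := by
      rw [hasDerivWithinAt_iff_isLittleO] at hvs ⊢
      simp only [sub_self, zero_smul, map_zero, smul_zero, sub_zero]
      refine Asymptotics.IsBigO.trans_isLittleO (Asymptotics.IsBigO.of_bound M ?_) hvs
      filter_upwards [self_mem_nhdsWithin] with u hu
      exact (T (t - u)).le_of_opNorm_le (hb _ (hmaps hu)) _
    have h2 : HasDerivWithinAt (fun u => (u - s) • T (t - u) (v' s)) (T (t - s) (v' s))
        (Icc 0 t) s := by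
      rw [hasDerivWithinAt_iff_tendsto_slope]
      have hc : ContinuousWithinAt (fun u => T (t - u) (v' s)) (Icc 0 t) s :=
        ((hT.continuousOn_orbit hb (v' s)) (t - s) (hmaps hs)).comp
          (f := fun u : ℝ => t - u) (by fun_prop) hmaps
      refine (hc.tendsto.mono_left (nhdsWithin_mono _ sdiff_subset)).congr' ?_
      filter_upwards [self_mem_nhdsWithin] with u hu
      have hne : u - s ≠ 0 := sub_ne_zero.2 fun h => hu.2 h
      simp [slope, smul_smul, hne]
    have h3 : HasDerivWithinAt (fun u => T (t - u) (v s)) (-T (t - s) (v' s)) (Icc 0 t) s := by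
      have hg := hG.hasDerivWithinAt_orbit hT hb (hmem s hs.1) (hmaps hs)
      have hsub : HasDerivWithinAt (fun u : ℝ => t - u) (-1) (Icc 0 t) s :=
        ((hasDerivAt_id s).const_sub t).hasDerivWithinAt
      simpa [Function.comp_def] using hg.scomp s hsub hmaps
    have h := (h1.add h2).add h3
    rw [zero_add, add_neg_cancel] at h
    refine h.congr (fun u _ => ?_) ?_
    · simp only [Pi.add_apply]
      rw [← Complex.coe_smul (u - s) (T (t - u) (v' s)), ← map_smul, ← map_add, ← map_add,
        Complex.coe_smul]
      congr 1; abel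
    · simp
  have hc : ContinuousOn (fun u => T (t - u) (v u)) (Icc 0 t) := fun s hs =>
    (hd s hs).continuousWithinAt
  have := constant_of_has_deriv_right_zero hc (fun s hs =>
    ((hd s ⟨hs.1, hs.2.le⟩).mono_of_mem_nhdsWithin
      (mem_of_superset (Icc_mem_nhdsGE hs.2) (Icc_subset_Icc_left hs.1)))) t ⟨ht, le_rfl⟩
  simpa [hT.zero] using this

theorem tendsto_exp_neg_mul_atTop {a : ℝ} (ha : 0 < a) :
    Tendsto (fun t : ℝ => Real.exp (-a * t)) atTop (𝓝 0) :=
  Real.tendsto_exp_atBot.comp (tendsto_id.const_mul_atTop_of_neg (neg_lt_zero.2 ha))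

theorem IsGeneratorGraph.eq_zero_of_mem [CompleteSpace Y] (hT : IsC0Semigroup T)
    (hG : IsGeneratorGraph T G) (hM : 0 < M) (ha : 0 < a)
    (hb : ∀ t : ℝ, 0 ≤ t → ‖T t‖ ≤ M * Real.exp (-a * t)) {x : Y} (h : (x, 0) ∈ G) : x = 0 := by
  have hx : ∀ t : ℝ, 0 ≤ t → x = T t x := fun t ht =>
    hG.eq_orbit hT (fun t ht => norm_le_of_exp_bound hM ha hb ht) (v := fun _ => x)
      (v' := fun _ => 0) (fun t _ => hasDerivWithinAt_const _ _ _) (fun _ _ => h) ht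
  have hlim : Tendsto (fun t : ℝ => M * Real.exp (-a * t) * ‖x‖) atTop (𝓝 0) := by
    simpa using ((tendsto_exp_neg_mul_atTop ha).const_mul M).mul_const ‖x‖
  refine norm_le_zero_iff.1 (ge_of_tendsto hlim ?_)
  filter_upwards [eventually_ge_atTop 0] with t ht
  conv_lhs => rw [hx t ht]
  exact (T t).le_of_opNorm_le (hb t ht) x

open MeasureTheory in
theorem IsGeneratorGraph.exists_resolvent [CompleteSpace Y] (hT : IsC0Semigroup T)
    (hG : IsGeneratorGraph T G) (hM : 0 < M) (ha : 0 < a)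
    (hb : ∀ t : ℝ, 0 ≤ t → ‖T t‖ ≤ M * Real.exp (-a * t)) {μ : ℂ} (hμ : 0 ≤ μ.re) (f : Y) :
    ∃ x : Y, (x, μ • x - f) ∈ G := by
  have hcont : ContinuousOn (fun s : ℝ => Complex.exp (-μ * s) • T s f) (Ici 0) :=
    (by fun_prop : Continuous fun s : ℝ => Complex.exp (-μ * s)).continuousOn.smul
      (hT.continuousOn_orbit (fun t ht => norm_le_of_exp_bound hM ha hb ht) f)
  set g : ℝ → Y := fun s => Complex.exp (-μ * s) • T s f with hg
  have hint : IntegrableOn g (Ioi 0) := by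
    have he : IntegrableOn (fun s : ℝ => M * ‖f‖ * Real.exp (-a * s)) (Ioi 0) :=
      (integrableOn_exp_mul_Ioi (neg_lt_zero.2 ha) 0).const_mul _
    refine Integrable.mono' he
      ((hcont.mono Ioi_subset_Ici_self).aestronglyMeasurable measurableSet_Ioi) ?_
    filter_upwards [ae_restrict_mem measurableSet_Ioi] with s hs
    have hs' : (0 : ℝ) ≤ s := (mem_Ioi.1 hs).le
    have h1 : ‖Complex.exp (-μ * s)‖ ≤ 1 := by
      rw [Complex.norm_exp, Real.exp_le_one_iff]
      simp only [Complex.mul_re, Complex.neg_re, Complex.ofReal_re, Complex.ofReal_im, mul_zero,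
        sub_zero]
      nlinarith
    calc ‖g s‖ = ‖Complex.exp (-μ * s)‖ * ‖T s f‖ := norm_smul _ _
      _ ≤ 1 * (M * Real.exp (-a * s) * ‖f‖) := by
        gcongr
        exact (T s).le_of_opNorm_le (hb s hs') f
      _ = _ := by ring
  set x : Y := ∫ s in Ioi 0, g s with hx
  refine ⟨x, (hG _ _).2 ?_⟩
  have hstep : ∀ h : ℝ, 0 < h → T h x = Complex.exp (μ * h) • (x - ∫ s in (0 : ℝ)..h, g s) := by
    intro h hh
    have e1 : T h x = ∫ s in Ioi 0, T h (g s) := ((T h).integral_comp_comm hint).symm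
    have e2 : ∫ s in Ioi 0, T h (g s) = ∫ s in Ioi 0, Complex.exp (μ * h) • g (s + h) := by
      refine setIntegral_congr_fun measurableSet_Ioi fun s hs => ?_
      simp only [hg, map_smul, smul_smul, ← Complex.exp_add]
      rw [← hT.add_apply hh.le (mem_Ioi.1 hs).le, add_comm h s]
      congr 2
      push_cast; ring
    have e3 : ∫ s in Ioi 0, g (s + h) = ∫ s in Ioi h, g s := by
      have := (measurePreserving_add_right volume h).setIntegral_preimage_emb
        (measurableEmbedding_addRight h) g (Ioi h)
      simpa using this
    have e4 : (∫ s in (0 : ℝ)..h, g s) + ∫ s in Ioi h, g s = x :=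
      intervalIntegral.integral_interval_add_Ioi hint (hint.mono_set (Ioi_subset_Ioi hh.le))
    rw [e1, e2, integral_smul, e3, ← e4, add_sub_cancel_left]
  have hfirst : Tendsto (fun h : ℝ => ((h⁻¹ : ℝ) : ℂ) • ∫ s in (0 : ℝ)..h, g s) (𝓝[>] 0)
      (𝓝 f) := by
    have hd : HasDerivWithinAt (fun h => ∫ s in (0 : ℝ)..h, g s) (g 0) (Ici 0) 0 := by
      refine intervalIntegral.integral_hasDerivWithinAt_right (by simp)
        (t := Ioi 0) ?_ ((hcont 0 self_mem_Ici).mono Ioi_subset_Ici_self)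
      exact ⟨Ioi 0, self_mem_nhdsWithin,
        (hcont.mono Ioi_subset_Ici_self).aestronglyMeasurable measurableSet_Ioi⟩
    have h0 : g 0 = f := by simp [hg, hT.zero]
    rw [h0] at hd
    have := (hasDerivWithinAt_iff_tendsto_slope' (by simp)).1 (hd.mono Ioi_subset_Ici_self)
    refine this.congr fun h => ?_
    rw [Complex.coe_smul]
    simp [slope]
  have hexp : Tendsto (fun h : ℝ => ((h⁻¹ : ℝ) : ℂ) * (Complex.exp (μ * h) - 1)) (𝓝[>] 0)
      (𝓝 μ) := by
    have hd : HasDerivAt (fun h : ℝ => Complex.exp (μ * h)) μ 0 := by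
      have := ((Complex.ofRealCLM.hasDerivAt (x := 0)).const_mul μ).cexp
      simpa using this
    have := (hasDerivWithinAt_iff_tendsto_slope' (by simp)).1 (hd.hasDerivWithinAt (s := Ioi 0))
    refine this.congr fun h => ?_
    simp [slope]
  have hone : Tendsto (fun h : ℝ => Complex.exp (μ * h)) (𝓝[>] 0) (𝓝 1) := by
    have : Continuous fun h : ℝ => Complex.exp (μ * h) := by fun_prop
    simpa using (this.tendsto 0).mono_left nhdsWithin_le_nhds
  have hlim := (hexp.smul_const x).sub (hone.smul hfirst)
  rw [one_smul] at hlim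
  refine hlim.congr' ?_
  filter_upwards [self_mem_nhdsWithin] with h hh
  rw [hstep h hh, smul_sub, smul_sub, smul_sub, mul_smul, sub_smul, one_smul, smul_sub,
    smul_comm (Complex.exp (μ * h))]
  abel

end ExpStable
/-! ### Signals as sums of exponentials -/

/-- The exponents `±iω_k` of the signals with frequencies `ω_k`. -/
noncomputable def signalExponent {q : ℕ} (ω : Fin (q + 1) → ℝ) :
    Fin (q + 1) ⊕ Fin (q + 1) → ℂ :=
  Sum.elim (fun k => Complex.I * ω k) (fun k => -(Complex.I * ω k))

theorem signalExponent_re {q : ℕ} (ω : Fin (q + 1) → ℝ) (j : Fin (q + 1) ⊕ Fin (q + 1)) :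
    (signalExponent ω j).re = 0 := by
  rcases j with k | k <;> simp [signalExponent]

theorem IsTrigSignal.exists_exp {q n : ℕ} {ω : Fin (q + 1) → ℝ} (hω₀ : ω 0 = 0)
    {f : ℝ → CVec n} (hf : IsTrigSignal ω f) :
    ∃ c : Fin (q + 1) ⊕ Fin (q + 1) → CVec n,
      ∀ t : ℝ, f t = ∑ j, Complex.exp (signalExponent ω j * t) • c j := by
  obtain ⟨a₀, a₁, a₂, h⟩ := hf
  refine ⟨Sum.elim (Fin.cons a₀ fun k => (1 / 2 : ℂ) • (a₁ k - Complex.I • a₂ k))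
    (Fin.cons 0 fun k => (1 / 2 : ℂ) • (a₁ k + Complex.I • a₂ k)), fun t => ?_⟩
  rw [h, Fintype.sum_sum_type]
  simp only [signalExponent, Sum.elim_inl, Sum.elim_inr, Fin.sum_univ_succ, Fin.cons_zero,
    Fin.cons_succ, hω₀, Complex.ofReal_zero, mul_zero, zero_mul, Complex.exp_zero, one_smul,
    smul_zero, zero_add]
  rw [add_assoc, ← Finset.sum_add_distrib]
  refine congrArg (a₀ + ·) (Finset.sum_congr rfl fun k _ => ?_)
  rw [Complex.ofReal_cos, Complex.ofReal_sin, Complex.cos, Complex.sin]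
  have e1 : Complex.I * (ω k.succ : ℂ) * t = ((ω k.succ * t : ℝ) : ℂ) * Complex.I := by
    push_cast; ring
  have e2 : -(Complex.I * (ω k.succ : ℂ)) * t = -((ω k.succ * t : ℝ) : ℂ) * Complex.I := by
    push_cast; ring
  rw [e1, e2]
  module

/-! ### The closed-loop system -/

namespace ErrorController

variable {X Z : Type*} [NormedAddCommGroup X] [InnerProductSpace ℂ X]
  [NormedAddCommGroup Z] [InnerProductSpace ℂ Z] {p n₁ n₃ nc : ℕ}

theorem continuous_opAe (K : ErrorController p nc) (S : BoundarySystem X Z p n₁ n₃) :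
    Continuous (K.opAe S) := by
  change Continuous fun v : Z × CVec nc =>
    (S.A₀ v.1, -((K.δ : ℂ) • K.B (S.C v.1)) + K.J v.2)
  fun_prop

theorem continuous_opBe (K : ErrorController p nc) (S : BoundarySystem X Z p n₁ n₃) :
    Continuous (K.opBe S) := by
  change Continuous fun v : Z × CVec nc =>
    (S.B v.1 + K.D (S.C v.1) - (K.δ : ℂ) • ContinuousLinearMap.adjoint K.B v.2, S.Bd v.1)
  fun_prop

theorem mem_graphAe {K : ErrorController p nc} {S : BoundarySystem X Z p n₁ n₃}
    {f g : X × CVec nc} :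
    (f, g) ∈ K.graphAe S ↔ ∃ v, K.opBe S v = 0 ∧ (S.ι v.1, v.2) = f ∧ K.opAe S v = g := by
  simp [graphAe, Submodule.mem_map, LinearMap.prod_apply]

/-- The inverse of the closed-loop operator is bounded from `X × X_c` into `Z × X_c`. -/
theorem exists_inverse [CompleteSpace X] [CompleteSpace Z] {K : ErrorController p nc}
    {S : BoundarySystem X Z p n₁ n₃} (h : GeneratesExpStableSemigroup (K.graphAe S)) :
    ∃ R : X × CVec nc →L[ℂ] Z × CVec nc, ∀ v, K.opBe S v = 0 → R (K.opAe S v) = v := by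
  obtain ⟨T, hT, hG, M, hM, a, ha, hb⟩ := h
  set W := LinearMap.ker (K.opBe S)
  have hclosed : IsClosed (W : Set (Z × CVec nc)) :=
    isClosed_singleton.preimage (K.continuous_opBe S)
  have : CompleteSpace W := hclosed.completeSpace_coe
  let A : W →L[ℂ] X × CVec nc :=
    ⟨(K.opAe S).comp W.subtype, (K.continuous_opAe S).comp continuous_subtype_val⟩
  have hinj : LinearMap.ker (A : W →ₗ[ℂ] X × CVec nc) = ⊥ := by
    refine LinearMap.ker_eq_bot'.2 fun w hw => ?_
    have h0 := hG.eq_zero_of_mem hT hM ha hb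
      (mem_graphAe.2 ⟨w.1, w.2, rfl, hw⟩)
    obtain ⟨h1, h2⟩ := Prod.mk.inj (h0 : _ = ((0 : X), (0 : CVec nc)))
    exact Subtype.ext (Prod.ext (S.ι_injective (h1.trans (map_zero S.ι).symm)) h2)
  have hsurj : LinearMap.range (A : W →ₗ[ℂ] X × CVec nc) = ⊤ := by
    refine LinearMap.range_eq_top.2 fun f => ?_
    obtain ⟨x, hx⟩ := hG.exists_resolvent hT hM ha hb (μ := 0) le_rfl (-f)
    obtain ⟨v, hv, -, hvf⟩ := mem_graphAe.1 hx
    rw [zero_smul, zero_sub, neg_neg] at hvf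
    exact ⟨⟨v, hv⟩, hvf⟩
  let e := ContinuousLinearEquiv.ofBijective A hinj hsurj
  refine ⟨W.subtypeL.comp (e.symm : X × CVec nc →L[ℂ] W), fun v hv => ?_⟩
  exact congrArg Subtype.val (e.symm_apply_apply ⟨v, hv⟩)

/-- For an exponent in the closed right half-plane at which the range condition holds, the
closed-loop system has a stationary response without regulation error. -/
theorem exists_stationary [CompleteSpace X] {K : ErrorController p nc}
    {S : BoundarySystem X Z p n₁ n₃} (hsurj : Function.Surjective fun z : Z => (S.B z, S.Bd z))
    (hD : K.D = 0) (hδ : 0 < K.δ) (hker : K.B.ker = ⊥)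
    (h : GeneratesExpStableSemigroup (K.graphAe S)) {μ : ℂ} (hμ : 0 ≤ μ.re)
    (hran : (μ • ContinuousLinearMap.id ℂ (CVec nc) - K.J).range ⊓ K.B.range = ⊥)
    (r : CVec p) (w₁ : CVec n₁) (w₂ : CVec p) (w₃ : CVec n₃) :
    ∃ (z : Z) (xc : CVec nc), μ • S.ι z = S.A₀ z + S.E w₁ ∧
      S.B z = (K.δ : ℂ) • ContinuousLinearMap.adjoint K.B xc + w₂ ∧ S.Bd z = w₃ ∧
      μ • xc = K.J xc ∧ S.C z = r := by
  obtain ⟨T, hT, hG, M, hM, a, ha, hb⟩ := h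
  obtain ⟨z₀, hz₀⟩ := hsurj (w₂, w₃)
  obtain ⟨hB₀, hBd₀⟩ := Prod.mk.inj hz₀
  obtain ⟨f, hf⟩ := hG.exists_resolvent hT hM ha hb hμ
    (-(μ • S.ι z₀) + S.A₀ z₀ + S.E w₁, (K.δ : ℂ) • K.B (r - S.C z₀))
  obtain ⟨⟨z, xc⟩, hv, rfl, hA⟩ := mem_graphAe.1 hf
  obtain ⟨hB, hBd⟩ := Prod.mk.inj (hv : _ = ((0 : CVec p), (0 : CVec n₃)))
  obtain ⟨hA₁, hA₂⟩ := Prod.mk.inj hA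
  simp only [Prod.smul_fst, Prod.smul_snd] at hA₁ hA₂ hB hBd
  have hxc : μ • xc - K.J xc = (K.δ : ℂ) • K.B (r - S.C (z + z₀)) := by
    have e : r - S.C (z + z₀) = (r - S.C z₀) - S.C z := by rw [map_add]; abel
    rw [e, map_sub, smul_sub]
    linear_combination (norm := module) (-1 : ℂ) • hA₂
  have hmem : (K.δ : ℂ) • K.B (r - S.C (z + z₀)) ∈
      (μ • ContinuousLinearMap.id ℂ (CVec nc) - K.J).range ⊓ K.B.range :=
    ⟨⟨xc, by simpa using hxc⟩, ⟨(K.δ : ℂ) • (r - S.C (z + z₀)), by simp⟩⟩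
  rw [hran, Submodule.mem_bot] at hmem
  have hδ' : (K.δ : ℂ) ≠ 0 := Complex.ofReal_ne_zero.2 hδ.ne'
  have hr : r - S.C (z + z₀) ∈ K.B.ker := (smul_eq_zero.1 hmem).resolve_left hδ'
  rw [hker, Submodule.mem_bot] at hr
  refine ⟨z + z₀, xc, ?_, ?_, ?_, ?_, (sub_eq_zero.1 hr).symm⟩
  · simp only [map_add, smul_add]
    linear_combination (norm := module) (-1 : ℂ) • hA₁
  · rw [map_add, hB₀, ← sub_eq_zero, ← hB, hD]
    simp only [zero_apply]
    module
  · rw [map_add, hBd, hBd₀, zero_add]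
  · rw [← sub_eq_zero, hxc, hmem]

/-- The closed-loop equations with `D = 0`. -/
theorem isClosedLoopState_iff {K : ErrorController p nc} (hD : K.D = 0)
    {S : BoundarySystem X Z p n₁ n₃} {r : ℝ → CVec p} {w₁ : ℝ → CVec n₁} {w₂ : ℝ → CVec p}
    {w₃ : ℝ → CVec n₃} {x : ℝ → Z} {xc : ℝ → CVec nc} :
    K.IsClosedLoopState S r w₁ w₂ w₃ x xc ↔ ContinuousOn x (Ici 0) ∧ ∀ t : ℝ, 0 ≤ t →
      HasDerivWithinAt (fun s => (S.ι (x s), xc s))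
        (K.opAe S (x t, xc t) + (S.E (w₁ t), (K.δ : ℂ) • K.B (r t))) (Ici 0) t ∧
      K.opBe S (x t, xc t) = (w₂ t, w₃ t) := by
  have hA : ∀ t, K.opAe S (x t, xc t) + (S.E (w₁ t), (K.δ : ℂ) • K.B (r t)) =
      (S.A₀ (x t) + S.E (w₁ t), K.J (xc t) + (K.δ : ℂ) • K.B (r t - S.C (x t))) := by
    intro t
    refine Prod.ext rfl ?_
    change -((K.δ : ℂ) • K.B (S.C (x t))) + K.J (xc t) + (K.δ : ℂ) • K.B (r t) = _
    rw [map_sub, smul_sub]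
    module
  have hB : ∀ t, K.opBe S (x t, xc t) = (w₂ t, w₃ t) ↔
      S.B (x t) = K.control (xc t) (S.C (x t)) (r t) + w₂ t ∧ S.Bd (x t) = w₃ t := by
    intro t
    change (S.B (x t) + K.D (S.C (x t)) - (K.δ : ℂ) • ContinuousLinearMap.adjoint K.B (xc t),
      S.Bd (x t)) = _ ↔ _
    simp only [Prod.mk.injEq, control, hD, zero_apply, add_zero,
      sub_eq_iff_eq_add']
  constructor
  · rintro ⟨h1, h2, h3, h4, h5⟩
    refine ⟨h1, fun t ht => ⟨?_, (hB t).2 ⟨h3 t ht, h4 t ht⟩⟩⟩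
    rw [hA]
    exact (h2 t ht).prodMk (h5 t ht)
  · rintro ⟨h1, h2⟩
    refine ⟨h1, fun t ht => ?_, fun t ht => ((hB t).1 (h2 t ht).2).1,
      fun t ht => ((hB t).1 (h2 t ht).2).2, fun t ht => ?_⟩
    · have := (h2 t ht).1
      rw [hA] at this
      exact (ContinuousLinearMap.fst ℝ X (CVec nc)).hasFDerivAt.comp_hasDerivWithinAt t this
    · have := (h2 t ht).1
      rw [hA] at this
      exact (ContinuousLinearMap.snd ℝ X (CVec nc)).hasFDerivAt.comp_hasDerivWithinAt t this

/-- A closed-loop state along which the output equals the reference. -/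
theorem exists_tracking_state [CompleteSpace X] {K : ErrorController p nc}
    {S : BoundarySystem X Z p n₁ n₃} (hsurj : Function.Surjective fun z : Z => (S.B z, S.Bd z))
    (hD : K.D = 0) (hδ : 0 < K.δ) (hker : K.B.ker = ⊥)
    (h : GeneratesExpStableSemigroup (K.graphAe S)) {q : ℕ} {ω : Fin (q + 1) → ℝ}
    (hω₀ : ω 0 = 0)
    (hran : ∀ j, (signalExponent ω j • ContinuousLinearMap.id ℂ (CVec nc) - K.J).range ⊓
      K.B.range = ⊥)
    {r : ℝ → CVec p} {w₁ : ℝ → CVec n₁} {w₂ : ℝ → CVec p} {w₃ : ℝ → CVec n₃}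
    (hr : IsTrigSignal ω r) (hw₁ : IsTrigSignal ω w₁) (hw₂ : IsTrigSignal ω w₂)
    (hw₃ : IsTrigSignal ω w₃) :
    ∃ (x : ℝ → Z) (xc : ℝ → CVec nc), K.IsClosedLoopState S r w₁ w₂ w₃ x xc ∧
      ∀ t, S.C (x t) = r t := by
  obtain ⟨r', hr'⟩ := hr.exists_exp hω₀
  obtain ⟨w₁', hw₁'⟩ := hw₁.exists_exp hω₀
  obtain ⟨w₂', hw₂'⟩ := hw₂.exists_exp hω₀
  obtain ⟨w₃', hw₃'⟩ := hw₃.exists_exp hω₀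
  choose z ξ hA hB hBd hJ hC using fun j =>
    exists_stationary hsurj hD hδ hker h (signalExponent_re ω j).ge (hran j)
      (r' j) (w₁' j) (w₂' j) (w₃' j)
  have hexp : ∀ (j) (t : ℝ), HasDerivAt (fun s : ℝ => Complex.exp (signalExponent ω j * s))
      (Complex.exp (signalExponent ω j * t) * signalExponent ω j) t := by
    intro j t
    have := ((Complex.ofRealCLM.hasDerivAt (x := t)).const_mul (signalExponent ω j)).cexp
    simpa using this
  have hCr : ∀ t : ℝ, S.C (∑ j, Complex.exp (signalExponent ω j * t) • z j) = r t := by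
    intro t
    simp only [map_sum, map_smul, hC, hr']
  refine ⟨fun t => ∑ j, Complex.exp (signalExponent ω j * t) • z j,
    fun t => ∑ j, Complex.exp (signalExponent ω j * t) • ξ j,
    ⟨?_, fun t _ => ?_, fun t _ => ?_, fun t _ => ?_, fun t _ => ?_⟩, hCr⟩
  · exact Continuous.continuousOn (by fun_prop)
  · have hd : HasDerivAt (fun s : ℝ => ∑ j, Complex.exp (signalExponent ω j * s) • S.ι (z j))
        (∑ j, (Complex.exp (signalExponent ω j * t) * signalExponent ω j) • S.ι (z j)) t :=
      HasDerivAt.fun_sum fun j _ => (hexp j t).smul_const _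
    convert hd.hasDerivWithinAt (s := Ici 0) using 1
    · funext s; simp only [map_sum, map_smul]
    · simp only [mul_smul, hA, smul_add, Finset.sum_add_distrib, map_sum, map_smul, hw₁']
  · simp only [control, hD, zero_apply, add_zero, map_sum, map_smul, hB,
      smul_add, Finset.sum_add_distrib, hw₂', Finset.smul_sum]
    refine congrArg (· + _) (Finset.sum_congr rfl fun j _ => smul_comm _ _ _)
  · simp only [map_sum, map_smul, hBd, hw₃']
  · have hd : HasDerivAt (fun s : ℝ => ∑ j, Complex.exp (signalExponent ω j * s) • ξ j)
        (∑ j, (Complex.exp (signalExponent ω j * t) * signalExponent ω j) • ξ j) t :=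
      HasDerivAt.fun_sum fun j _ => (hexp j t).smul_const _
    refine hd.hasDerivWithinAt.congr_deriv ?_
    simp only [hCr, sub_self, map_zero, smul_zero, add_zero, mul_smul, hJ, map_sum, map_smul]

theorem regulates_of_expStable [CompleteSpace X] [CompleteSpace Z] {K : ErrorController p nc}
    {S : BoundarySystem X Z p n₁ n₃} (hsurj : Function.Surjective fun z : Z => (S.B z, S.Bd z))
    (hD : K.D = 0) (hδ : 0 < K.δ) (hker : K.B.ker = ⊥)
    (h : GeneratesExpStableSemigroup (K.graphAe S)) {q : ℕ} {ω : Fin (q + 1) → ℝ}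
    (hω₀ : ω 0 = 0)
    (hran : ∀ j, (signalExponent ω j • ContinuousLinearMap.id ℂ (CVec nc) - K.J).range ⊓
      K.B.range = ⊥) : K.Regulates S ω := by
  obtain ⟨R, hR⟩ := exists_inverse h
  have h' := h
  obtain ⟨T, hT, hG, M, hM, a, ha, hb⟩ := h'
  have hbM : ∀ t : ℝ, 0 ≤ t → ‖T t‖ ≤ M := fun t ht => norm_le_of_exp_bound hM ha hb ht
  refine ⟨a / 2, half_pos ha, fun r w₁ w₂ w₃ hr hw₁ hw₂ hw₃ x₀ xc₀ hB₀ hBd₀ => ?_⟩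
  obtain ⟨ξ, ξc, hξ, hξr⟩ := exists_tracking_state hsurj hD hδ hker h hω₀ hran hr hw₁ hw₂ hw₃
  have hξ' := (isClosedLoopState_iff hD).1 hξ
  constructor
  · set v₀ : Z × CVec nc := (x₀ - ξ 0, xc₀ - ξc 0) with hv₀
    have hv₀B : K.opBe S v₀ = 0 := by
      have h1 : K.opBe S (x₀, xc₀) = (w₂ 0, w₃ 0) := by
        refine Prod.ext ?_ hBd₀
        change S.B x₀ + K.D (S.C x₀) - (K.δ : ℂ) • ContinuousLinearMap.adjoint K.B xc₀ = w₂ 0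
        rw [hB₀, hD]
        simp [control, hD]
      have h2 : v₀ = (x₀, xc₀) - (ξ 0, ξc 0) := rfl
      rw [h2, map_sub, h1, (hξ'.2 0 le_rfl).2, sub_self]
    have hmem₀ : ((S.ι v₀.1, v₀.2), K.opAe S v₀) ∈ K.graphAe S :=
      mem_graphAe.2 ⟨v₀, hv₀B, rfl, rfl⟩
    set v : ℝ → Z × CVec nc := fun t => R (T t (K.opAe S v₀)) with hv
    have hvt : ∀ t, 0 ≤ t → K.opBe S (v t) = 0 ∧ (S.ι (v t).1, (v t).2) = T t (S.ι v₀.1, v₀.2) ∧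
        K.opAe S (v t) = T t (K.opAe S v₀) := by
      intro t ht
      obtain ⟨w, hw, hw1, hw2⟩ := mem_graphAe.1 (hG.orbit_mem hT hmem₀ ht)
      have : v t = w := by rw [hv]; simp only; rw [← hw2, hR w hw]
      rw [this]; exact ⟨hw, hw1, hw2⟩
    have hvc : ContinuousOn v (Ici 0) :=
      R.continuous.comp_continuousOn (hT.continuousOn_orbit hbM _)
    have hsum : ∀ t, (ξ t + (v t).1, ξc t + (v t).2) = (ξ t, ξc t) + v t := fun t => rfl
    refine ⟨fun t => ξ t + (v t).1, fun t => ξc t + (v t).2,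
      (isClosedLoopState_iff hD).2 ⟨hξ'.1.add (continuous_fst.comp_continuousOn hvc),
        fun t ht => ⟨?_, ?_⟩⟩, ?_, ?_⟩
    · have hd := (hξ'.2 t ht).1.add (hG.hasDerivWithinAt_orbit hT hbM hmem₀ ht)
      rw [hsum, map_add, (hvt t ht).2.2, add_right_comm]
      have heq : ∀ s ∈ Ici (0 : ℝ), (S.ι (ξ s + (v s).1), ξc s + (v s).2) =
          (S.ι (ξ s), ξc s) + T s (S.ι v₀.1, v₀.2) := by
        intro s hs
        rw [← (hvt s hs).2.1, map_add]; rfl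
      exact hd.congr heq (heq t ht)
    · rw [hsum, map_add, (hvt t ht).1, add_zero, (hξ'.2 t ht).2]
    · have : v 0 = v₀ := by simp only [hv, hT.zero]; exact hR v₀ hv₀B
      simp only [this, hv₀, add_sub_cancel]
    · have : v 0 = v₀ := by simp only [hv, hT.zero]; exact hR v₀ hv₀B
      simp only [this, hv₀, add_sub_cancel]
  · rintro x xc hx - -
    have hx' := (isClosedLoopState_iff hD).1 hx
    set v : ℝ → Z × CVec nc := fun t => (x t, xc t) - (ξ t, ξc t) with hv
    have hvB : ∀ t, 0 ≤ t → K.opBe S (v t) = 0 := fun t ht => by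
      rw [hv]; simp only; rw [map_sub, (hx'.2 t ht).2, (hξ'.2 t ht).2, sub_self]
    have hmem : ∀ t, 0 ≤ t → ((S.ι (v t).1, (v t).2), K.opAe S (v t)) ∈ K.graphAe S :=
      fun t ht => mem_graphAe.2 ⟨v t, hvB t ht, rfl, rfl⟩
    have hderiv : ∀ t, 0 ≤ t → HasDerivWithinAt (fun s => (S.ι (v s).1, (v s).2))
        (K.opAe S (v t)) (Ici 0) t := by
      intro t ht
      have hd := (hx'.2 t ht).1.sub (hξ'.2 t ht).1
      rw [add_sub_add_right_eq_sub, ← map_sub] at hd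
      have heq : ∀ s, (S.ι (v s).1, (v s).2) = (S.ι (x s), xc s) - (S.ι (ξ s), ξc s) := by
        intro s
        simp only [hv, map_sub, Prod.mk_sub_mk]
      exact hd.congr (fun s _ => heq s) (heq t)
    have hsol : ∀ t, 0 ≤ t → v t = R (T t (K.opAe S (v 0))) := by
      intro t ht
      have h1 := hG.eq_orbit hT hbM hderiv hmem ht
      obtain ⟨w, hw, hw1, hw2⟩ := mem_graphAe.1 (hG.orbit_mem hT (hmem 0 le_rfl) ht)
      have h2 : v t = w := by
        rw [← h1] at hw1
        obtain ⟨e1, e2⟩ := Prod.mk.inj hw1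
        exact (Prod.ext (S.ι_injective e1) e2).symm
      rw [h2, ← hw2, hR w hw]
    have hlim : Tendsto (fun t : ℝ => ‖S.C‖ * (‖R‖ * (M * ‖K.opAe S (v 0)‖)) *
        Real.exp (-(a / 2) * t)) atTop (𝓝 0) := by
      simpa using (tendsto_exp_neg_mul_atTop (half_pos ha)).const_mul
        (‖S.C‖ * (‖R‖ * (M * ‖K.opAe S (v 0)‖)))
    refine squeeze_zero' (Eventually.of_forall fun t => by positivity) ?_ hlim
    filter_upwards [eventually_ge_atTop 0] with t ht
    have hCv : S.C (x t) - r t = S.C (v t).1 := by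
      rw [← hξr t, ← map_sub]; rfl
    have hbound : ‖S.C (v t).1‖ ≤
        ‖S.C‖ * (‖R‖ * (M * Real.exp (-a * t) * ‖K.opAe S (v 0)‖)) := by
      refine (S.C.le_opNorm _).trans ?_
      gcongr
      refine (norm_fst_le _).trans ?_
      rw [hsol t ht]
      refine (R.le_opNorm _).trans ?_
      gcongr
      exact (T t).le_of_opNorm_le (hb t ht) _
    rw [hCv]
    calc Real.exp (a / 2 * t) * ‖S.C (v t).1‖
        ≤ Real.exp (a / 2 * t) *
          (‖S.C‖ * (‖R‖ * (M * Real.exp (-a * t) * ‖K.opAe S (v 0)‖))) := by gcongr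
      _ = ‖S.C‖ * (‖R‖ * (M * ‖K.opAe S (v 0)‖)) *
          (Real.exp (a / 2 * t) * Real.exp (-a * t)) := by ring
      _ = _ := by
        rw [← Real.exp_add]
        congr 2; ring

end ErrorController

theorem mainTheorem3 {X Z : Type*}
    [NormedAddCommGroup X] [InnerProductSpace ℂ X] [CompleteSpace X]
    [NormedAddCommGroup Z] [InnerProductSpace ℂ Z] [CompleteSpace Z]
    {p n₁ n₃ nc q : ℕ}
    (ω : Fin (q + 1) → ℝ) (hω₀ : ω 0 = 0) (hω : StrictMono ω)
    (S : BoundarySystem X Z p n₁ n₃) (hS : S.Admissible)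
    (K : ErrorController p nc)
    (hJ : ContinuousLinearMap.adjoint K.J = -K.J) (hD : K.D = 0) (hδ : 0 < K.δ)
    (hstable : GeneratesExpStableSemigroup (K.graphAe S))
    (hran_pos : ∀ k : Fin (q + 1),
      ((Complex.I * (ω k : ℂ)) • ContinuousLinearMap.id ℂ (CVec nc) - K.J).range ⊓
        K.B.range = ⊥)
    (hran_neg : ∀ k : Fin (q + 1),
      ((-(Complex.I * (ω k : ℂ))) • ContinuousLinearMap.id ℂ (CVec nc) - K.J).range ⊓
        K.B.range = ⊥)
    (hker : K.B.ker = ⊥) :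
    K.SolvesRobustOutputRegulation S ω ∧
    ∃ α > (0 : ℝ),
      ∀ (r : ℝ → CVec p) (w₁ : ℝ → CVec n₁) (w₂ : ℝ → CVec p) (w₃ : ℝ → CVec n₃),
        IsTrigSignal ω r → IsTrigSignal ω w₁ → IsTrigSignal ω w₂ → IsTrigSignal ω w₃ →
        ∀ (x₀ : Z) (xc₀ : CVec nc),
          S.B x₀ = (K.δ : ℂ) • ContinuousLinearMap.adjoint K.B xc₀ + w₂ 0 →
          S.Bd x₀ = w₃ 0 →
            K.ErrorDecaysFrom S α r w₁ w₂ w₃ x₀ xc₀ := by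
  have hran : ∀ j, (signalExponent ω j • ContinuousLinearMap.id ℂ (CVec nc) - K.J).range ⊓
      K.B.range = ⊥ := by
    rintro (k | k)
    · exact hran_pos k
    · exact hran_neg k
  have hreg : ∀ S' : BoundarySystem X Z p n₁ n₃, S'.Admissible →
      GeneratesExpStableSemigroup (K.graphAe S') → K.Regulates S' ω := fun S' hS' hst =>
    ErrorController.regulates_of_expStable hS'.surjective hD hδ hker hst hω₀ hran
  refine ⟨⟨hstable, hreg S hS hstable, hreg⟩, ?_⟩
  obtain ⟨α, hα, h⟩ := hreg S hS hstable
  refine ⟨α, hα, fun r w₁ w₂ w₃ hr hw₁ hw₂ hw₃ x₀ xc₀ hB hBd =>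
    h r w₁ w₂ w₃ hr hw₁ hw₂ hw₃ x₀ xc₀ ?_ hBd⟩
  simpa [ErrorController.control, hD] using hB
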